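/- Let $(M_n)_{n\ge 0}$ be a sequence of positive real numbers with $M_0=1$ and $\frac{M_{n+m}}{M_nM_m}\ge\binom{n+m}{n}$ for all $n,m\ge 0$, and suppose that $(M_n)$ is non-quasi-analytic, i.e. $\sum_{n\ge 0} \frac{M_n}{M_{n+1}}<\infty$. Let $$D([0,1],M)=\Big\{f\in C^\infty([0,1],\mathbb C):\ \|f\|_D=\sum_{n=0}^\infty\frac{\|f^{(n)}\|_\infty}{M_n}<\infty\Big\},$$ a normed algebra under pointwise operations and the norm $\|\cdot\|_D$ (derivatives at $0$ and $1$ are one-sided, and $\|\cdot\|_\infty$ is the supremum norm on $[0,1]$). Let $\varphi:[0,1]\to[0,1]$ be a map that induces a compact endomorphism of $D([0,1],M)$; that is, $f\circ\varphi\in D([0,1],M)$ for every $f\in D([0,1],M)$, and the algebra endomorphism $f\mapsto f\circ\varphi$ of $D([0,1],M)$ is a compact operator. Then $\varphi$ is differentiable on $[0,1]$ and $$|\varphi'(x)|<1\quad\text{for every }x\in(0,1).$$ Consequently, if in addition $|\varphi'|$ attains its maximum over $[0,1]$ at some point of $(0,1)$, then $\|\varphi'\|_\infty=\sup_{x\in[0,1]}|\varphi'(x)|<1$.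 -/

import Mathlib

open Set (Icc range IccExtend)

/-- A weight (algebra) sequence: positive reals `M 0, M 1, …` with `M 0 = 1` and
`M (n + m) / (M n * M m) ≥ (n + m choose n)`. -/
structure WeightSeq where
  /-- the terms of the sequence -/
  seq : ℕ → ℝ
  pos : ∀ n, 0 < seq n
  zero_eq_one : seq 0 = 1
  choose_le : ∀ n m, ((n + m).choose n : ℝ) ≤ seq (n + m) / (seq n * seq m)

/-- Non-quasi-analyticity: `∑ M n / M (n + 1) < ∞`. -/
def WeightSeq.NonQuasiAnalytic (M : WeightSeq) : Prop :=
  Summable fun n => M.seq n / M.seq (n + 1)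

namespace DAlg

noncomputable section

variable {a b : ℝ}

/-- `f` is infinitely differentiable on the compact interval `[a, b]` (one-sided derivatives at the
endpoints). The values of `IccExtend` outside `[a, b]` play no role. -/
def Smooth (hab : a < b) (f : Icc a b → ℂ) : Prop :=
  ContDiffOn ℝ (⊤ : ℕ∞) (IccExtend hab.le f) (Icc a b)

/-- The `n`-th derivative of `f` on `[a, b]`, one-sided at the endpoints. -/
def nthDeriv (hab : a < b) (n : ℕ) (f : Icc a b → ℂ) (x : Icc a b) : ℂ :=
  iteratedDerivWithin n (IccExtend hab.le f) (Icc a b) x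

/-- The uniform norm over `[a, b]` of the `n`-th derivative of `f`. -/
def derivSup (hab : a < b) (n : ℕ) (f : Icc a b → ℂ) : ℝ :=
  ⨆ x : Icc a b, ‖nthDeriv hab n f x‖

lemma iccExtend_add (hab : a < b) (f g : Icc a b → ℂ) :
    IccExtend hab.le (f + g) = IccExtend hab.le f + IccExtend hab.le g := rfl

lemma iccExtend_smul (hab : a < b) (c : ℂ) (f : Icc a b → ℂ) :
    IccExtend hab.le (c • f) = c • IccExtend hab.le f := rfl

lemma nthDeriv_add (hab : a < b) (n : ℕ) {f g : Icc a b → ℂ} (hf : Smooth hab f)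
    (hg : Smooth hab g) (x : Icc a b) :
    nthDeriv hab n (f + g) x = nthDeriv hab n f x + nthDeriv hab n g x := by
  unfold nthDeriv
  rw [iccExtend_add hab]
  exact iteratedDerivWithin_add x.2 (uniqueDiffOn_Icc hab)
    ((hf x x.2).of_le (by exact_mod_cast le_top)) ((hg x x.2).of_le (by exact_mod_cast le_top))

lemma nthDeriv_smul (hab : a < b) (n : ℕ) (c : ℂ) {f : Icc a b → ℂ} (hf : Smooth hab f)
    (x : Icc a b) : nthDeriv hab n (c • f) x = c * nthDeriv hab n f x := by
  unfold nthDeriv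
  rw [iccExtend_smul hab]
  exact iteratedDerivWithin_const_smul x.2 (uniqueDiffOn_Icc hab) c
    ((hf x x.2).of_le (by exact_mod_cast le_top))

lemma norm_nthDeriv_mul_le (hab : a < b) (n : ℕ) {f g : Icc a b → ℂ} (hf : Smooth hab f)
    (hg : Smooth hab g) (x : Icc a b) :
    ‖nthDeriv hab n (f * g) x‖ ≤ ∑ i ∈ Finset.range (n + 1),
      (n.choose i : ℝ) * ‖nthDeriv hab i f x‖ * ‖nthDeriv hab (n - i) g x‖ := by
  unfold nthDeriv
  simp only [← norm_iteratedFDerivWithin_eq_norm_iteratedDerivWithin]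
  exact norm_iteratedFDerivWithin_mul_le hf hg (uniqueDiffOn_Icc hab) x.2
    (by exact_mod_cast le_top)

lemma bddAbove_nthDeriv (hab : a < b) (n : ℕ) {f : Icc a b → ℂ} (hf : Smooth hab f) :
    BddAbove (range fun x : Icc a b => ‖nthDeriv hab n f x‖) := by
  have h := (hf.continuousOn_iteratedDerivWithin (m := n) (by exact_mod_cast le_top)
    (uniqueDiffOn_Icc hab)).norm
  have h2 := isCompact_Icc.bddAbove_image h
  rwa [Set.image_eq_range] at h2

lemma norm_le_derivSup (hab : a < b) (n : ℕ) {f : Icc a b → ℂ} (hf : Smooth hab f)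
    (x : Icc a b) : ‖nthDeriv hab n f x‖ ≤ derivSup hab n f :=
  le_ciSup (bddAbove_nthDeriv hab n hf) x

lemma derivSup_nonneg (hab : a < b) (n : ℕ) (f : Icc a b → ℂ) : 0 ≤ derivSup hab n f :=
  Real.iSup_nonneg fun _ => norm_nonneg _

lemma derivSup_le (hab : a < b) {n : ℕ} {f : Icc a b → ℂ} {C : ℝ}
    (h : ∀ x, ‖nthDeriv hab n f x‖ ≤ C) : derivSup hab n f ≤ C :=
  have : Nonempty (Icc a b) := ⟨⟨a, Set.left_mem_Icc.2 hab.le⟩⟩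
  ciSup_le h

lemma derivSup_add_le (hab : a < b) (n : ℕ) {f g : Icc a b → ℂ} (hf : Smooth hab f)
    (hg : Smooth hab g) : derivSup hab n (f + g) ≤ derivSup hab n f + derivSup hab n g :=
  derivSup_le hab fun x => by
    rw [nthDeriv_add hab n hf hg]
    exact (norm_add_le _ _).trans
      (add_le_add (norm_le_derivSup hab n hf x) (norm_le_derivSup hab n hg x))

lemma derivSup_smul (hab : a < b) (n : ℕ) (c : ℂ) {f : Icc a b → ℂ} (hf : Smooth hab f) :
    derivSup hab n (c • f) = ‖c‖ * derivSup hab n f := by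
  unfold derivSup
  simp_rw [nthDeriv_smul hab n c hf, norm_mul]
  exact (Real.mul_iSup_of_nonneg (norm_nonneg c) _).symm

lemma smooth_const (hab : a < b) (c : ℂ) : Smooth hab (fun _ => c) := contDiffOn_const

lemma smooth_add (hab : a < b) {f g : Icc a b → ℂ} (hf : Smooth hab f)
    (hg : Smooth hab g) : Smooth hab (f + g) := ContDiffOn.add hf hg

lemma smooth_mul (hab : a < b) {f g : Icc a b → ℂ} (hf : Smooth hab f)
    (hg : Smooth hab g) : Smooth hab (f * g) := ContDiffOn.mul hf hg

lemma derivSup_const (hab : a < b) (n : ℕ) (c : ℂ) :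
    derivSup hab n (fun _ => c) = if n = 0 then ‖c‖ else 0 := by
  have : Nonempty (Icc a b) := ⟨⟨a, Set.left_mem_Icc.2 hab.le⟩⟩
  have : ∀ x : Icc a b, nthDeriv hab n (fun _ => c) x = if n = 0 then c else 0 := fun x => by
    have h : IccExtend hab.le (fun _ : Icc a b => c) = fun _ => c := rfl
    simp [nthDeriv, h, iteratedDerivWithin_const]
  simp only [derivSup, this, ciSup_const]
  split_ifs <;> simp

/-- The terms `‖f⁽ⁿ⁾‖_∞ / M n` of the norm. -/
def term (hab : a < b) (M : WeightSeq) (f : Icc a b → ℂ) (n : ℕ) : ℝ :=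
  derivSup hab n f / M.seq n

lemma term_nonneg (hab : a < b) (M : WeightSeq) (f : Icc a b → ℂ) (n : ℕ) :
    0 ≤ term hab M f n := div_nonneg (derivSup_nonneg hab n f) (M.pos n).le

lemma term_add_le (hab : a < b) (M : WeightSeq) {f g : Icc a b → ℂ} (hf : Smooth hab f)
    (hg : Smooth hab g) (n : ℕ) :
    term hab M (f + g) n ≤ term hab M f n + term hab M g n := by
  unfold term
  rw [← add_div]
  exact div_le_div_of_nonneg_right (derivSup_add_le hab n hf hg) (M.pos n).le

lemma term_smul (hab : a < b) (M : WeightSeq) (c : ℂ) {f : Icc a b → ℂ} (hf : Smooth hab f)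
    (n : ℕ) : term hab M (c • f) n = ‖c‖ * term hab M f n := by
  unfold term
  rw [derivSup_smul hab n c hf, mul_div_assoc]

lemma term_mul_le (hab : a < b) (M : WeightSeq) {f g : Icc a b → ℂ} (hf : Smooth hab f)
    (hg : Smooth hab g) (n : ℕ) :
    term hab M (f * g) n ≤
      ∑ p ∈ Finset.HasAntidiagonal.antidiagonal n, term hab M f p.1 * term hab M g p.2 := by
  rw [Finset.Nat.sum_antidiagonal_eq_sum_range_succ_mk]
  unfold term
  rw [div_le_iff₀ (M.pos n), Finset.sum_mul]
  refine derivSup_le hab fun x => (norm_nthDeriv_mul_le hab n hf hg x).trans ?_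
  refine Finset.sum_le_sum fun i hi => ?_
  have hin : i + (n - i) = n := by have := Finset.mem_range.1 hi; omega
  have h1 := M.choose_le i (n - i)
  rw [hin] at h1
  have hA := norm_le_derivSup hab i hf x
  have hB := norm_le_derivSup hab (n - i) hg x
  have hA0 := derivSup_nonneg hab i f
  have hB0 := derivSup_nonneg hab (n - i) g
  calc (n.choose i : ℝ) * ‖nthDeriv hab i f x‖ * ‖nthDeriv hab (n - i) g x‖
      ≤ (M.seq n / (M.seq i * M.seq (n - i))) * derivSup hab i f * derivSup hab (n - i) g := by
        have := (Nat.cast_nonneg (α := ℝ) (n.choose i)).trans h1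
        gcongr
    _ = _ := by
        have := (M.pos i).ne'
        have := (M.pos (n - i)).ne'
        field_simp

/-- `D([a, b], M)` as a subalgebra of the algebra of all functions `[a, b] → ℂ` with pointwise
operations: the smooth `f` with `∑ ‖f⁽ⁿ⁾‖_∞ / M n < ∞`. -/
def subalgebra (hab : a < b) (M : WeightSeq) : Subalgebra ℂ (Icc a b → ℂ) where
  carrier := {f | Smooth hab f ∧ Summable (term hab M f)}
  add_mem' {f g} hf hg := ⟨smooth_add hab hf.1 hg.1,
    Summable.of_nonneg_of_le (term_nonneg hab M _) (term_add_le hab M hf.1 hg.1)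
      (hf.2.add hg.2)⟩
  mul_mem' {f g} hf hg := ⟨smooth_mul hab hf.1 hg.1,
    Summable.of_nonneg_of_le (term_nonneg hab M _) (term_mul_le hab M hf.1 hg.1)
      (summable_sum_mul_antidiagonal_of_summable_mul
        (hf.2.mul_of_nonneg hg.2 (term_nonneg hab M f) (term_nonneg hab M g)))⟩
  algebraMap_mem' c := ⟨smooth_const hab c, by
    refine summable_of_ne_finset_zero (s := {0}) fun n hn => ?_
    have h : derivSup hab n (algebraMap ℂ (Icc a b → ℂ) c) = if n = 0 then ‖c‖ else 0 :=
      derivSup_const hab n c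
    have hn' : n ≠ 0 := by simpa using hn
    simp [term, h, hn']⟩

end

end DAlg

/-- The algebra `D([a, b], M)` of the infinitely differentiable `f : [a, b] → ℂ` with
`∑ ‖f⁽ⁿ⁾‖_∞ / M n < ∞`. It is a type of its own so that the only topology on it is that of its
norm, and not the topology of pointwise convergence. -/
def DAlg {a b : ℝ} (hab : a < b) (M : WeightSeq) : Type := DAlg.subalgebra hab M

namespace DAlg

noncomputable section

variable {a b : ℝ} {hab : a < b} {M : WeightSeq}

instance : CommRing (DAlg hab M) := inferInstanceAs (CommRing (subalgebra hab M))

instance : Algebra ℂ (DAlg hab M) := inferInstanceAs (Algebra ℂ (subalgebra hab M))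

instance : CoeFun (DAlg hab M) fun _ => Icc a b → ℂ := ⟨fun f => f.1⟩

/-- `‖f‖_D = ∑ ‖f⁽ⁿ⁾‖_∞ / M n`. -/
instance : Norm (DAlg hab M) := ⟨fun f => ∑' n, derivSup hab n f / M.seq n⟩

lemma norm_eq (f : DAlg hab M) : ‖f‖ = ∑' n, term hab M f n := rfl

lemma norm_smul_eq (c : ℂ) (f : DAlg hab M) : ‖c • f‖ = ‖c‖ * ‖f‖ := by
  rw [norm_eq, norm_eq, ← tsum_mul_left]
  exact tsum_congr fun n => term_smul hab M c f.2.1 n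

instance : NormedCommRing (DAlg hab M) :=
  let N : RingNorm (DAlg hab M) :=
    { toFun := fun f => ‖f‖
      map_zero' := by
        have := norm_smul_eq (0 : ℂ) (0 : DAlg hab M)
        rwa [norm_zero, zero_mul, zero_smul] at this
      add_le' := fun f g => by
        rw [norm_eq, norm_eq, norm_eq, ← f.2.2.tsum_add g.2.2]
        exact (f + g).2.2.tsum_le_tsum (term_add_le hab M f.2.1 g.2.1) (f.2.2.add g.2.2)
      neg' := fun f => by
        have := norm_smul_eq (-1 : ℂ) f
        rwa [neg_smul, one_smul, norm_neg, norm_one, one_mul] at this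
      mul_le' := fun f g => by
        have hs := f.2.2.mul_of_nonneg g.2.2 (term_nonneg hab M f) (term_nonneg hab M g)
        rw [norm_eq, norm_eq, norm_eq, f.2.2.tsum_mul_tsum_eq_tsum_sum_antidiagonal g.2.2 hs]
        exact (f * g).2.2.tsum_le_tsum (term_mul_le hab M f.2.1 g.2.1)
          (summable_sum_mul_antidiagonal_of_summable_mul hs)
      eq_zero_of_map_eq_zero' := fun f hf => by
        have h0 : term hab M f 0 ≤ 0 :=
          (f.2.2.le_tsum 0 fun n _ => term_nonneg hab M f n).trans (le_of_eq hf)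
        have h1 : derivSup hab 0 f ≤ 0 := by
          simpa [term, M.zero_eq_one] using h0
        refine Subtype.ext (funext fun x => ?_)
        have h2 := (norm_le_derivSup hab 0 f.2.1 x).trans h1
        have h3 : nthDeriv hab 0 f x = f x := by simp [nthDeriv]
        rw [h3] at h2
        exact norm_le_zero_iff.1 h2 }
  { N.toNormedRing, (inferInstance : CommRing (DAlg hab M)),
    (inferInstance : Norm (DAlg hab M)) with }

instance : NormedAlgebra ℂ (DAlg hab M) where
  norm_smul_le c f := (norm_smul_eq c f).le

end

/-- The selfmap `φ` of `[a, b]` induces a compact endomorphism of `D([a, b], M)`: there is an algebra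
endomorphism `T` of `D([a, b], M)` with `T f = f ∘ φ` for all `f`, and `T` is a compact operator. -/
def InducesCompactEndomorphism {a b : ℝ} (hab : a < b) (M : WeightSeq)
    (φ : Icc a b → Icc a b) : Prop :=
  ∃ T : DAlg hab M →ₐ[ℂ] DAlg hab M,
    (∀ (f : DAlg hab M) (x : Icc a b), T f x = f (φ x)) ∧ IsCompactOperator T

/-- The real function on the line that extends a selfmap of `[a, b]`; only its values on `[a, b]`
are used. -/
noncomputable def realMap {a b : ℝ} (hab : a < b) (φ : Icc a b → Icc a b) : ℝ → ℝ :=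
  IccExtend hab.le fun x => (φ x : ℝ)

/-- The derivative `φ'` of a selfmap `φ` of `[a, b]`, one-sided at the endpoints. -/
noncomputable def selfmapDeriv {a b : ℝ} (hab : a < b) (φ : Icc a b → Icc a b)
    (x : Icc a b) : ℝ :=
  derivWithin (realMap hab φ) (Icc a b) x

end DAlg

/-!
Let `x₀` be an interior point with `φ' x₀ = l`. Composing with a cutoff `χ` at `x₀` and the
translation that carries `φ x₀` to `x₀` turns the given endomorphism into a compact operator that
preserves the flag of the spaces of functions vanishing to order `n` at `x₀`; its `n`-th diagonal
entry is `l ^ n * χ x₀`. By Riesz's lemma the diagonal entries of a compact operator along a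
strictly decreasing flag of closed subspaces tend to zero, so `|l| < 1`. Non-quasi-analyticity
provides the cutoff: it is an infinite convolution of normalized indicator functions of intervals.
-/

open Filter Topology
open scoped ContDiff

section Flag

variable {𝕜 E : Type*} [NontriviallyNormedField 𝕜] [NormedAddCommGroup E] [NormedSpace 𝕜 E]

lemma exists_bounded_seq_of_flag {F : ℕ → Submodule 𝕜 E}
    (hF : ∀ n, F (n + 1) < F n) (hFc : ∀ n, IsClosed (F n : Set E)) :
    ∃ (R : ℝ) (f : ℕ → E), ∀ n, f n ∈ F n ∧ ‖f n‖ ≤ R ∧ ∀ y ∈ F (n + 1), 1 ≤ ‖f n - y‖ := by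
  obtain ⟨c, hc⟩ := NormedField.exists_one_lt_norm 𝕜
  refine ⟨‖c‖ + 1, ?_⟩
  choose f hf using fun n => riesz_lemma_of_norm_lt hc (lt_add_one ‖c‖)
    (F := (F (n + 1)).comap (F n).subtype) ((hFc (n + 1)).preimage continuous_subtype_val)
    (let ⟨x, hx, hx'⟩ := SetLike.exists_of_lt (hF n); ⟨⟨x, hx⟩, hx'⟩)
  exact ⟨fun n => f n, fun n => ⟨(f n).2, (hf n).1,
    fun y hy => (hf n).2 ⟨y, (hF n).le hy⟩ hy⟩⟩

lemma norm_le_norm_map_sub_map_of_flag {K : E →ₗ[𝕜] E} {F : ℕ → Submodule 𝕜 E} (hF : Antitone F)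
    {c : ℕ → 𝕜} (hK : ∀ n, ∀ f ∈ F n, K f - c n • f ∈ F (n + 1)) {m n : ℕ} (hmn : m < n) {f g : E}
    (hf : f ∈ F m) (hg : g ∈ F n) (hdist : ∀ y ∈ F (m + 1), 1 ≤ ‖f - y‖) :
    ‖c m‖ ≤ ‖K f - K g‖ := by
  rcases eq_or_ne (c m) 0 with hc | hc
  · simp [hc]
  have hKg : K g ∈ F n := by
    simpa using (F n).add_mem (hF n.le_succ (hK n g hg)) ((F n).smul_mem (c n) hg)
  have hrem : K g - (K f - c m • f) ∈ F (m + 1) := (F (m + 1)).sub_mem (hF hmn hKg) (hK m f hf)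
  calc ‖c m‖ ≤ ‖c m‖ * ‖f - (c m)⁻¹ • (K g - (K f - c m • f))‖ :=
        le_mul_of_one_le_right (norm_nonneg _) (hdist _ ((F (m + 1)).smul_mem _ hrem))
    _ = ‖K f - K g‖ := by
        rw [← norm_smul, smul_sub, smul_inv_smul₀ hc]
        congr 1
        abel

theorem tendsto_zero_of_isCompactOperator_of_flag {K : E →ₗ[𝕜] E} (hK : IsCompactOperator K)
    {F : ℕ → Submodule 𝕜 E} (hF : ∀ n, F (n + 1) < F n) (hFc : ∀ n, IsClosed (F n : Set E))
    {c : ℕ → 𝕜} (hKF : ∀ n, ∀ f ∈ F n, K f - c n • f ∈ F (n + 1)) :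
    Tendsto c atTop (𝓝 0) := by
  obtain ⟨R, f, hf⟩ := exists_bounded_seq_of_flag hF hFc
  by_contra hc
  obtain ⟨ε, hε, hfreq⟩ : ∃ ε > 0, ∃ᶠ n in atTop, ε ≤ ‖c n‖ := by
    simpa [Metric.tendsto_nhds, frequently_atTop] using hc
  obtain ⟨ι, hι, hcι⟩ := extraction_of_frequently_atTop hfreq
  obtain ⟨S, hS, hKS⟩ := hK.image_closedBall_subset_compact R
  obtain ⟨y, -, κ, hκ, hlim⟩ := hS.tendsto_subseq (x := fun k => K (f (ι k)))
    fun k => hKS ⟨f (ι k), mem_closedBall_zero_iff.2 (hf _).2.1, rfl⟩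
  obtain ⟨N, hN⟩ := Metric.cauchySeq_iff'.1 hlim.cauchySeq ε hε
  have hlt : ι (κ N) < ι (κ (N + 1)) := hι (hκ N.lt_succ_self)
  have hsep := norm_le_norm_map_sub_map_of_flag (antitone_nat_of_succ_le fun n => (hF n).le) hKF hlt
    (hf _).1 (hf _).1 (hf _).2.2
  have hclose := hN (N + 1) N.le_succ
  rw [dist_comm, dist_eq_norm] at hclose
  exact (((hcι _).trans hsep).trans_lt hclose).false

end Flag

section LeadingTerm

variable {E : Type*} [NormedAddCommGroup E] [NormedSpace ℝ E]

/-- `f x = (x - x₀) ^ n • α + o((x - x₀) ^ n)` as `x → x₀`. The remainder is hidden in a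
factorization `f x = (x - x₀) ^ n • g x` with `g → α`, which composes and multiplies well. -/
def HasLeadingTerm (f : ℝ → E) (x₀ : ℝ) (n : ℕ) (α : E) : Prop :=
  ∃ g : ℝ → E, Tendsto g (𝓝 x₀) (𝓝 α) ∧ f =ᶠ[𝓝 x₀] fun x => (x - x₀) ^ n • g x

namespace HasLeadingTerm

variable {f f₁ f₂ : ℝ → E} {x₀ : ℝ} {m n : ℕ} {α β : E}

lemma congr (hf : HasLeadingTerm f₁ x₀ n α) (h : f₁ =ᶠ[𝓝 x₀] f₂) : HasLeadingTerm f₂ x₀ n α :=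
  let ⟨g, hg, hfg⟩ := hf
  ⟨g, hg, h.symm.trans hfg⟩

lemma sub (hf : HasLeadingTerm f₁ x₀ n α) (hg : HasLeadingTerm f₂ x₀ n β) :
    HasLeadingTerm (f₁ - f₂) x₀ n (α - β) := by
  obtain ⟨g₁, hg₁, hfg₁⟩ := hf
  obtain ⟨g₂, hg₂, hfg₂⟩ := hg
  refine ⟨g₁ - g₂, hg₁.sub hg₂, ?_⟩
  filter_upwards [hfg₁, hfg₂] with x h₁ h₂
  simp only [Pi.sub_apply, h₁, h₂, smul_sub]

lemma of_lt (hf : HasLeadingTerm f x₀ n α) (hmn : m < n) : HasLeadingTerm f x₀ m 0 := by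
  obtain ⟨g, hg, hfg⟩ := hf
  have hpow : Tendsto (fun x => (x - x₀) ^ (n - m)) (𝓝 x₀) (𝓝 0) := by
    have h : Continuous fun x => (x - x₀) ^ (n - m) := by fun_prop
    simpa [Nat.sub_ne_zero_of_lt hmn] using h.tendsto x₀
  refine ⟨fun x => (x - x₀) ^ (n - m) • g x, by simpa using hpow.smul hg, ?_⟩
  filter_upwards [hfg] with x hx
  rw [hx, smul_smul, pow_mul_pow_sub _ hmn.le]

lemma unique (h₁ : HasLeadingTerm f x₀ n α) (h₂ : HasLeadingTerm f x₀ n β) : α = β := by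
  obtain ⟨g₁, hg₁, hfg₁⟩ := h₁
  obtain ⟨g₂, hg₂, hfg₂⟩ := h₂
  refine tendsto_nhds_unique_of_eventuallyEq (hg₁.mono_left nhdsWithin_le_nhds)
    (hg₂.mono_left nhdsWithin_le_nhds) (?_ : g₁ =ᶠ[𝓝[≠] x₀] g₂)
  filter_upwards [nhdsWithin_le_nhds (hfg₁.symm.trans hfg₂), self_mem_nhdsWithin] with x hx hne
  exact smul_right_injective E (pow_ne_zero n (sub_ne_zero.2 hne)) hx

lemma comp (hf : HasLeadingTerm f x₀ n α) {ψ : ℝ → ℝ} {l : ℝ} (hψ : HasDerivAt ψ l x₀)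
    (hfix : ψ x₀ = x₀) : HasLeadingTerm (f ∘ ψ) x₀ n (l ^ n • α) := by
  obtain ⟨g, hg, hfg⟩ := hf
  have hψt : Tendsto ψ (𝓝 x₀) (𝓝 x₀) := by simpa [hfix] using hψ.continuousAt.tendsto
  have hslope : Tendsto (dslope ψ x₀) (𝓝 x₀) (𝓝 l) := by
    simpa [hψ.deriv] using (continuousAt_dslope_same.2 hψ.differentiableAt).tendsto
  refine ⟨fun x => dslope ψ x₀ x ^ n • g (ψ x), (hslope.pow n).smul (hg.comp hψt), ?_⟩
  filter_upwards [hψt.eventually hfg] with x hx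
  rw [Function.comp_apply, hx, smul_smul, ← mul_pow, ← smul_eq_mul, sub_smul_dslope, hfix]

lemma mul_left {A : Type*} [NormedRing A] [NormedAlgebra ℝ A] {f : ℝ → A} {α : A}
    (hf : HasLeadingTerm f x₀ n α) {u : ℝ → A} (hu : ContinuousAt u x₀) :
    HasLeadingTerm (u * f) x₀ n (u x₀ * α) := by
  obtain ⟨g, hg, hfg⟩ := hf
  refine ⟨u * g, hu.tendsto.mul hg, ?_⟩
  filter_upwards [hfg] with x hx
  simp only [Pi.mul_apply, hx, mul_smul_comm]

end HasLeadingTerm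

variable {f : ℝ → E} {s : Set ℝ} {x₀ : ℝ} {n : ℕ} {α : E}

lemma hasLeadingTerm_of_iteratedDerivWithin_eq_zero (hf : ContDiffOn ℝ n f s) (hs : Convex ℝ s)
    (hx₀ : s ∈ 𝓝 x₀) (h : ∀ j < n, iteratedDerivWithin j f s x₀ = 0) :
    HasLeadingTerm f x₀ n ((n.factorial : ℝ)⁻¹ • iteratedDerivWithin n f s x₀) := by
  set α := (n.factorial : ℝ)⁻¹ • iteratedDerivWithin n f s x₀ with hα
  have htaylor (x : ℝ) : taylorWithinEval f n s x₀ x = (x - x₀) ^ n • α := by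
    rw [taylor_within_apply, Finset.sum_range_succ, Finset.sum_eq_zero fun j hj => by
      rw [h j (Finset.mem_range.1 hj), smul_zero], zero_add, mul_comm, mul_smul]
  have hlim := taylor_tendsto hs (mem_of_mem_nhds hx₀) hf
  rw [nhdsWithin_eq_nhds.2 hx₀] at hlim
  refine ⟨_, by simpa only [zero_add] using hlim.add_const α, .of_forall fun x => ?_⟩
  beta_reduce
  rw [smul_add, ← htaylor x]
  rcases eq_or_ne x x₀ with rfl | hx
  · simp
  · rw [smul_inv_smul₀ (pow_ne_zero n (sub_ne_zero.2 hx)), sub_add_cancel]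

lemma HasLeadingTerm.iteratedDerivWithin_eq_zero (h : HasLeadingTerm f x₀ n α)
    (hf : ContDiffOn ℝ n f s) (hs : Convex ℝ s) (hx₀ : s ∈ 𝓝 x₀) {j : ℕ} (hj : j < n) :
    iteratedDerivWithin j f s x₀ = 0 := by
  induction j using Nat.strong_induction_on with
  | _ j ih =>
    have hj' := hasLeadingTerm_of_iteratedDerivWithin_eq_zero (hf.of_le (by exact_mod_cast hj.le))
      hs hx₀ fun i hi => ih i hi (hi.trans hj)
    simpa [Nat.factorial_ne_zero] using hj'.unique (h.of_lt hj)

lemma HasLeadingTerm.eq_iteratedDerivWithin (h : HasLeadingTerm f x₀ n α)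
    (hf : ContDiffOn ℝ n f s) (hs : Convex ℝ s) (hx₀ : s ∈ 𝓝 x₀) :
    α = (n.factorial : ℝ)⁻¹ • iteratedDerivWithin n f s x₀ :=
  h.unique (hasLeadingTerm_of_iteratedDerivWithin_eq_zero hf hs hx₀ fun _ hj =>
    h.iteratedDerivWithin_eq_zero hf hs hx₀ hj)

end LeadingTerm

section BoxAverage

open BoundedContinuousFunction MeasureTheory

variable {E : Type*} [NormedAddCommGroup E] [NormedSpace ℝ E]

lemma norm_intervalAverage_le (f : ℝ →ᵇ E) (r x : ℝ) :
    ‖⨍ t in (x - r)..(x + r), f t‖ ≤ ‖f‖ := by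
  rw [interval_average_eq, norm_smul, norm_inv, Real.norm_eq_abs]
  exact inv_mul_le_of_le_mul₀ (abs_nonneg _) (norm_nonneg _) <|
    (intervalIntegral.norm_integral_le_of_norm_le_const fun t _ => f.norm_coe_le_norm t).trans_eq
      (mul_comm _ _)

variable [CompleteSpace E]

lemma norm_intervalAverage_sub_le {f : ℝ → E} (hf : Continuous f) {r : ℝ} (hr : 0 < r) {x C : ℝ}
    {c : E} (h : ∀ t, |t - x| ≤ r → ‖f t - c‖ ≤ C) :
    ‖(⨍ t in (x - r)..(x + r), f t) - c‖ ≤ C := by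
  have hle : x - r ≤ x + r := by linarith
  rw [Set.uIoc_of_le hle, ← mem_closedBall_iff_norm]
  refine (convex_closedBall c C).set_average_mem Metric.isClosed_closedBall
    (by simp [hr]) measure_Ioc_lt_top.ne ?_ hf.integrableOn_Ioc
  filter_upwards [ae_restrict_mem measurableSet_Ioc] with t ht
  exact mem_closedBall_iff_norm.2 (h t (abs_le.2 ⟨by linarith [ht.1], by linarith [ht.2]⟩))

lemma hasDerivAt_intervalAverage {f : ℝ → E} (hf : Continuous f) (r x : ℝ) :
    HasDerivAt (fun x => ⨍ t in (x - r)..(x + r), f t)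
      ((2 * r)⁻¹ • (f (x + r) - f (x - r))) x := by
  have hprim (y : ℝ) : HasDerivAt (fun z => ∫ t in (0 : ℝ)..z, f t) (f y) y :=
    hf.integral_hasStrictDerivAt 0 y |>.hasDerivAt
  have heq (y : ℝ) : (⨍ t in (y - r)..(y + r), f t) =
      (2 * r)⁻¹ • ((∫ t in (0 : ℝ)..(y + r), f t) - ∫ t in (0 : ℝ)..(y - r), f t) := by
    rw [interval_average_eq, intervalIntegral.integral_interval_sub_left
      (hf.intervalIntegrable _ _) (hf.intervalIntegrable _ _)]
    congr 2
    ring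
  simp only [heq]
  exact (((hprim _).comp_add_const x r).sub ((hprim _).comp_sub_const x r)).const_smul _

/-- The operator that replaces `f x` by the mean of `f` over `[x - r, x + r]`, that is, convolution
with the uniform probability density on `[-r, r]`. -/
noncomputable def boxAvg (r : ℝ) : (ℝ →ᵇ E) →L[ℝ] (ℝ →ᵇ E) :=
  LinearMap.mkContinuous
    { toFun := fun f => .ofNormedAddCommGroup (fun x => ⨍ t in (x - r)..(x + r), f t)
        (continuous_iff_continuousAt.2 fun x =>
          (hasDerivAt_intervalAverage f.continuous r x).continuousAt) ‖f‖
        (norm_intervalAverage_le f r)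
      map_add' := fun f g => by
        ext x
        simp [interval_average_eq, intervalIntegral.integral_add
          (f.continuous.intervalIntegrable _ _) (g.continuous.intervalIntegrable _ _)]
      map_smul' := fun c f => by
        ext x
        simp [interval_average_eq, smul_comm c] } 1
    fun f => by
      rw [one_mul]
      exact norm_ofNormedAddCommGroup_le _ (norm_nonneg f) (norm_intervalAverage_le f r)

lemma norm_boxAvg_le (r : ℝ) (f : ℝ →ᵇ E) : ‖boxAvg r f‖ ≤ ‖f‖ :=
  norm_ofNormedAddCommGroup_le _ (norm_nonneg f) (norm_intervalAverage_le f r)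

lemma hasDerivAt_boxAvg (r : ℝ) (f : ℝ →ᵇ E) (x : ℝ) :
    HasDerivAt (boxAvg r f) ((2 * r)⁻¹ • (f (x + r) - f (x - r))) x :=
  hasDerivAt_intervalAverage f.continuous r x

lemma norm_boxAvg_sub_self_le {r : ℝ} (hr : 0 < r) {f : ℝ →ᵇ E} (hf : LipschitzWith 1 f) :
    ‖boxAvg r f - f‖ ≤ r := by
  refine (norm_le hr.le).2 fun x => norm_intervalAverage_sub_le f.continuous hr fun t ht => ?_
  simpa [dist_eq_norm] using (hf.dist_le_mul t x).trans (by simpa [Real.dist_eq] using ht)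

lemma boxAvg_eq_zero {r R : ℝ} (hr : 0 < r) {f : ℝ →ᵇ E} (hf : ∀ x, R ≤ |x| → f x = 0) {x : ℝ}
    (hx : R + r ≤ |x|) : boxAvg r f x = 0 := by
  have h := norm_intervalAverage_sub_le f.continuous hr (x := x) (c := 0) (C := 0) fun t ht => by
    rw [hf t (by linarith [abs_sub_abs_le_abs_sub x t, abs_sub_comm x t]), sub_zero, norm_zero]
  rwa [sub_zero, norm_le_zero_iff] at h

/-- The composition of the averaging operators of half-widths `a 0, …, a (j - 1)`. -/
noncomputable def boxIter : ℕ → (ℕ → ℝ) → (ℝ →ᵇ E) →L[ℝ] (ℝ →ᵇ E)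
  | 0, _ => .id ℝ _
  | j + 1, a => boxAvg (a 0) ∘L boxIter j fun i => a (i + 1)

lemma boxIter_succ_apply (j : ℕ) (a : ℕ → ℝ) (f : ℝ →ᵇ E) :
    boxIter (j + 1) a f = boxAvg (a 0) (boxIter j (fun i => a (i + 1)) f) := rfl

lemma norm_boxIter_le (j : ℕ) (a : ℕ → ℝ) (f : ℝ →ᵇ E) : ‖boxIter j a f‖ ≤ ‖f‖ := by
  induction j generalizing a with
  | zero => rfl
  | succ j ih => exact (norm_boxAvg_le _ _).trans (ih _)

lemma dist_boxIter_succ_le {a : ℕ → ℝ} (ha : ∀ i, 0 < a i) {f : ℝ →ᵇ E} (hf : LipschitzWith 1 f)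
    (j : ℕ) : dist (boxIter j a f) (boxIter (j + 1) a f) ≤ a j := by
  rw [dist_comm, dist_eq_norm]
  induction j generalizing a with
  | zero => exact norm_boxAvg_sub_self_le (ha 0) hf
  | succ j ih =>
    rw [boxIter_succ_apply (j + 1) a, boxIter_succ_apply j a, ← map_sub]
    exact (norm_boxAvg_le _ _).trans (ih fun i => ha (i + 1))

lemma boxIter_eq_zero {a : ℕ → ℝ} (ha : ∀ i, 0 < a i) {R : ℝ} {f : ℝ →ᵇ E}
    (hf : ∀ x, R ≤ |x| → f x = 0) (j : ℕ) {x : ℝ} (hx : R + ∑ i ∈ Finset.range j, a i ≤ |x|) :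
    boxIter j a f x = 0 := by
  induction j generalizing a x with
  | zero => exact hf x (by simpa using hx)
  | succ j ih =>
    rw [Finset.sum_range_succ', ← add_assoc] at hx
    exact boxAvg_eq_zero (ha 0) (fun y hy => ih (fun i => ha (i + 1)) hy) hx

/-- The infinite convolution of `f` with the uniform densities on `[-a i, a i]`, meaningful for
summable `a` and Lipschitz `f`. -/
noncomputable def boxLimit (a : ℕ → ℝ) (f : ℝ →ᵇ E) : ℝ →ᵇ E :=
  limUnder atTop fun j => boxIter j a f

section boxLimit

variable {a : ℕ → ℝ} (ha : ∀ i, 0 < a i) (has : Summable a) {f : ℝ →ᵇ E} (hf : LipschitzWith 1 f)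
include ha has hf

lemma tendsto_boxIter : Tendsto (fun j => boxIter j a f) atTop (𝓝 (boxLimit a f)) :=
  (cauchySeq_of_dist_le_of_summable a (dist_boxIter_succ_le ha hf) has).tendsto_limUnder

lemma norm_boxLimit_le : ‖boxLimit a f‖ ≤ ‖f‖ :=
  le_of_tendsto (tendsto_boxIter ha has hf).norm (.of_forall fun j => norm_boxIter_le j a f)

lemma dist_boxLimit_le : dist f (boxLimit a f) ≤ ∑' i, a i :=
  dist_le_tsum_of_dist_le_of_tendsto₀ a (dist_boxIter_succ_le ha hf) has (tendsto_boxIter ha has hf)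

lemma boxLimit_eq_zero {R : ℝ} (hR : ∀ x, R ≤ |x| → f x = 0) {x : ℝ}
    (hx : R + ∑' i, a i ≤ |x|) : boxLimit a f x = 0 := by
  have hzero (j : ℕ) : boxIter j a f x = 0 := boxIter_eq_zero ha hR j <| le_trans
    (by grw [has.sum_le_tsum (Finset.range j) fun i _ => (ha i).le]) hx
  have hlim := ((continuous_eval_const x).tendsto _).comp (tendsto_boxIter ha has hf)
  exact tendsto_nhds_unique hlim (tendsto_const_nhds.congr fun j => (hzero j).symm)

lemma boxLimit_eq_boxAvg : boxLimit a f = boxAvg (a 0) (boxLimit (fun i => a (i + 1)) f) :=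
  tendsto_nhds_unique ((tendsto_boxIter ha has hf).comp (tendsto_add_atTop_nat 1)) <|
    ((boxAvg (a 0)).continuous.tendsto _).comp <|
      tendsto_boxIter (fun i => ha (i + 1)) ((summable_nat_add_iff 1).2 has) hf

lemma hasDerivAt_boxLimit (x : ℝ) : HasDerivAt (boxLimit a f) ((2 * a 0)⁻¹ •
    (boxLimit (fun i => a (i + 1)) f (x + a 0) - boxLimit (fun i => a (i + 1)) f (x - a 0))) x := by
  rw [boxLimit_eq_boxAvg ha has hf]
  exact hasDerivAt_boxAvg _ _ x

lemma deriv_boxLimit : deriv (boxLimit a f) = (2 * a 0)⁻¹ •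
    ((fun x => boxLimit (fun i => a (i + 1)) f (x + a 0)) -
      fun x => boxLimit (fun i => a (i + 1)) f (x - a 0)) :=
  funext fun x => (hasDerivAt_boxLimit ha has hf x).deriv

lemma contDiff_boxLimit (n : ℕ) : ContDiff ℝ n (boxLimit a f) := by
  induction n generalizing a with
  | zero => exact contDiff_zero.2 (boxLimit a f).continuous
  | succ n ih =>
    have hnext := ih (fun i => ha (i + 1)) ((summable_nat_add_iff 1).2 has)
    rw [Nat.cast_add, Nat.cast_one, contDiff_succ_iff_deriv]
    refine
      ⟨fun x => (hasDerivAt_boxLimit ha has hf x).differentiableAt, fun h => absurd h (by simp), ?_⟩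
    rw [deriv_boxLimit ha has hf]
    exact ((hnext.comp (contDiff_id.add contDiff_const)).sub
      (hnext.comp (contDiff_id.sub contDiff_const))).const_smul _

lemma norm_iteratedDeriv_boxLimit_le (n : ℕ) (x : ℝ) :
    ‖iteratedDeriv n (boxLimit a f) x‖ ≤ ‖f‖ * ∏ i ∈ Finset.range n, (a i)⁻¹ := by
  induction n generalizing a x with
  | zero => simpa using ((boxLimit a f).norm_coe_le_norm x).trans (norm_boxLimit_le ha has hf)
  | succ n ih =>
    have ha' (i : ℕ) : 0 < a (i + 1) := ha (i + 1)
    have has' : Summable fun i => a (i + 1) := (summable_nat_add_iff 1).2 has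
    have hsmooth := contDiff_boxLimit ha' has' hf n
    have hadd : ContDiff ℝ n fun x => boxLimit (fun i => a (i + 1)) f (x + a 0) :=
      hsmooth.comp (contDiff_id.add contDiff_const)
    have hsub : ContDiff ℝ n fun x => boxLimit (fun i => a (i + 1)) f (x - a 0) :=
      hsmooth.comp (contDiff_id.sub contDiff_const)
    have hbound := ih ha' has'
    rw [iteratedDeriv_succ', deriv_boxLimit ha has hf, Finset.prod_range_succ',
      iteratedDeriv_const_smul_field,
      iteratedDeriv_sub hadd.contDiffAt hsub.contDiffAt,
      iteratedDeriv_comp_add_const, iteratedDeriv_comp_sub_const, norm_smul, norm_inv,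
      Real.norm_of_nonneg (by linarith [ha 0])]
    set C := ‖f‖ * ∏ i ∈ Finset.range n, (a (i + 1))⁻¹ with hC
    calc _ ≤ (2 * a 0)⁻¹ * (C + C) := by
          have := ha 0
          grw [norm_sub_le, hbound, hbound]
      _ = _ := by
          have := (ha 0).ne'
          rw [hC]
          field_simp
          ring

end boxLimit

end BoxAverage

section Bump

lemma exists_tsum_lt_of_prod_inv_le {b : ℕ → ℝ} (hb : ∀ n, 0 < b n) (hs : Summable b) {δ : ℝ}
    (hδ : 0 < δ) : ∃ (a : ℕ → ℝ) (C : ℝ), (∀ n, 0 < a n) ∧ Summable a ∧ ∑' n, a n < δ ∧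
      ∀ n, ∏ i ∈ Finset.range n, (a i)⁻¹ ≤ C * ∏ i ∈ Finset.range n, (b i)⁻¹ := by
  have hle {t : ℝ} (ht : 0 ≤ t) (n : ℕ) : b n / (1 + t * b n) ≤ b n :=
    div_le_self (hb n).le (le_add_of_nonneg_right (mul_nonneg ht (hb n).le))
  have hpos {t : ℝ} (ht : 0 ≤ t) (n : ℕ) : 0 < b n / (1 + t * b n) := by
    have := hb n
    positivity
  have hlim : Tendsto (fun t : ℝ => ∑' n, b n / (1 + t * b n)) atTop (𝓝 (∑' _ : ℕ, 0)) := by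
    refine tendsto_tsum_of_dominated_convergence hs (fun n => ?_) ?_
    · exact (tendsto_atTop_add_const_left _ 1 (tendsto_id.atTop_mul_const (hb n))).const_div_atTop _
    · filter_upwards [eventually_ge_atTop 0] with t ht n
      rw [Real.norm_of_nonneg (hpos ht n).le]
      exact hle ht n
  rw [tsum_zero] at hlim
  obtain ⟨t, hlt, ht⟩ := ((hlim.eventually_lt_const hδ).and (eventually_ge_atTop 0)).exists
  refine ⟨fun n => b n / (1 + t * b n), Real.exp (t * ∑' n, b n), hpos ht,
    .of_nonneg_of_le (fun n => (hpos ht n).le) (hle ht) hs, hlt, fun n => ?_⟩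
  have hexp : ∏ i ∈ Finset.range n, (1 + t * b i) ≤ Real.exp (t * ∑' n, b n) := by
    refine (Real.prod_one_add_le_exp_sum _ fun i => mul_nonneg ht (hb i).le).trans ?_
    rw [← Finset.mul_sum]
    gcongr
    exact hs.sum_le_tsum _ fun i _ => (hb i).le
  simp only [inv_div]
  simp only [div_eq_mul_inv, Finset.prod_mul_distrib]
  exact mul_le_mul_of_nonneg_right hexp (Finset.prod_nonneg fun i _ => (inv_pos.2 (hb i)).le)

open BoundedContinuousFunction in
lemma exists_lipschitz_tent {d : ℝ} (hd : 0 ≤ d) : ∃ f : ℝ →ᵇ ℂ, LipschitzWith 1 f ∧ ‖f 0‖ = d ∧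
    ∀ x, d ≤ |x| → f x = 0 := by
  have hlip : LipschitzWith 1 fun x : ℝ => ((max 0 (d - |x|) : ℝ) : ℂ) := by
    have h : LipschitzWith 1 fun x : ℝ => d - |x| := by
      simpa using (LipschitzWith.const d).sub (lipschitzWith_one_norm (E := ℝ))
    simpa [Function.comp_def] using Complex.isometry_ofReal.lipschitz.comp (h.const_max 0)
  refine ⟨.ofNormedAddCommGroup _ hlip.continuous d fun x => ?_, hlip, ?_, fun x hx => ?_⟩
  · rw [Complex.norm_real, Real.norm_of_nonneg (le_max_left _ _)]
    exact max_le hd (sub_le_self _ (abs_nonneg x))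
  · simp [hd]
  · simpa using hx

theorem WeightSeq.NonQuasiAnalytic.exists_bump {M : WeightSeq} (hM : M.NonQuasiAnalytic) {δ : ℝ}
    (hδ : 0 < δ) : ∃ χ : ℝ → ℂ, ContDiff ℝ ∞ χ ∧ χ 0 ≠ 0 ∧ (∀ x, δ ≤ |x| → χ x = 0) ∧
      ∃ B : ℕ → ℝ, (∀ n x, ‖iteratedDeriv n χ x‖ ≤ B n) ∧ Summable fun n => B n / M.seq n := by
  -- The reciprocals of `M n / M (n + 1)` telescope to `M n`; doubling these ratios gains the
  -- geometric factor that makes the derivative bounds summable against `M`.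
  obtain ⟨a, C, ha, has, hsum, hprod⟩ := exists_tsum_lt_of_prod_inv_le
    (fun n => mul_pos two_pos (div_pos (M.pos n) (M.pos (n + 1)))) (hM.mul_left 2) (half_pos hδ)
  obtain ⟨f, hf, hf0, hfR⟩ := exists_lipschitz_tent (half_pos hδ).le
  have htelescope (n : ℕ) : ∏ i ∈ Finset.range n, (2 * (M.seq i / M.seq (i + 1)))⁻¹ =
      (1 / 2) ^ n * M.seq n := by
    induction n with
    | zero => simp [M.zero_eq_one]
    | succ n ih =>
      have := (M.pos n).ne'
      rw [Finset.prod_range_succ, ih]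
      field_simp
      ring
  refine ⟨boxLimit a f, contDiff_infty.2 (contDiff_boxLimit ha has hf), fun h0 => ?_,
    fun x hx => boxLimit_eq_zero ha has hf hfR (by linarith),
    _, norm_iteratedDeriv_boxLimit_le ha has hf, ?_⟩
  · have h := (f.dist_coe_le_dist 0).trans (dist_boxLimit_le ha has hf)
    rw [h0, dist_zero_right, hf0] at h
    exact hsum.not_ge h
  · refine .of_nonneg_of_le (fun n => div_nonneg (mul_nonneg (norm_nonneg _)
      (Finset.prod_nonneg fun i _ => (inv_pos.2 (ha i)).le)) (M.pos n).le) (fun n => ?_)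
      (summable_geometric_two.mul_left (‖f‖ * C))
    rw [div_le_iff₀ (M.pos n), mul_assoc, mul_assoc, ← htelescope]
    exact mul_le_mul_of_nonneg_left (hprod n) (norm_nonneg f)

lemma WeightSeq.NonQuasiAnalytic.exists_bump_of_mem_nhds {M : WeightSeq} (hM : M.NonQuasiAnalytic)
    {s : Set ℝ} {x₀ : ℝ} (hs : s ∈ 𝓝 x₀) : ∃ χ : ℝ → ℂ, ContDiff ℝ ∞ χ ∧ χ x₀ ≠ 0 ∧
      tsupport χ ⊆ s ∧ ∃ B : ℕ → ℝ, (∀ n x, ‖iteratedDeriv n χ x‖ ≤ B n) ∧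
        Summable fun n => B n / M.seq n := by
  obtain ⟨δ, hδ, hδs⟩ := Metric.nhds_basis_closedBall.mem_iff.1 hs
  obtain ⟨χ, hχ, hχ0, hχδ, B, hB, hBs⟩ := hM.exists_bump hδ
  refine ⟨fun x => χ (x - x₀), hχ.comp (contDiff_id.sub contDiff_const), by simpa using hχ0,
    (closure_minimal (fun x hx => ?_) Metric.isClosed_closedBall).trans hδs, B, fun n x => ?_, hBs⟩
  · rw [Metric.mem_closedBall, Real.dist_eq]
    exact (not_le.1 fun h => hx (hχδ _ h)).le
  · rw [iteratedDeriv_comp_sub_const]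
    exact hB n _

end Bump

namespace DAlg

variable {a b : ℝ} {hab : a < b} {M : WeightSeq}

/-- A function known to lie in the subalgebra, as an element of the normed algebra `DAlg`. -/
def ofMem {f : Icc a b → ℂ} (hf : f ∈ subalgebra hab M) : DAlg hab M :=
  (⟨f, hf⟩ : subalgebra hab M)

lemma ext {f g : DAlg hab M} (h : ∀ x, f x = g x) : f = g :=
  Subtype.ext (funext h)

section Restrict

variable {w : ℝ → ℂ} (hw : ContDiff ℝ ∞ w)
include hw

lemma smooth_restrict (hab : a < b) : Smooth hab fun x => w x :=
  hw.contDiffOn.congr fun _ hx => Set.IccExtend_of_mem hab.le _ hx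

lemma nthDeriv_restrict (hab : a < b) (n : ℕ) (x : Icc a b) :
    nthDeriv hab n (fun x => w x) x = iteratedDeriv n w x := by
  rw [nthDeriv, iteratedDerivWithin_congr (fun _ hx => Set.IccExtend_of_mem hab.le _ hx) x.2]
  exact iteratedDerivWithin_eq_iteratedDeriv (uniqueDiffOn_Icc hab)
    (hw.contDiffAt.of_le (by exact_mod_cast le_top)) x.2

lemma restrict_mem_subalgebra {B : ℕ → ℝ} (hB : ∀ n, ∀ x ∈ Icc a b, ‖iteratedDeriv n w x‖ ≤ B n)
    (hBs : Summable fun n => B n / M.seq n) : (fun x : Icc a b => w x) ∈ subalgebra hab M :=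
  ⟨smooth_restrict hw hab, .of_nonneg_of_le (term_nonneg hab M _) (fun n =>
    div_le_div_of_nonneg_right (derivSup_le hab fun x => by
      rw [nthDeriv_restrict hw]
      exact hB n x x.2) (M.pos n).le) hBs⟩

lemma norm_iteratedDeriv_le_derivSup (hsupp : tsupport w ⊆ Icc a b) (n : ℕ) (x : ℝ) :
    ‖iteratedDeriv n w x‖ ≤ derivSup hab n fun x => w x := by
  by_cases hx : x ∈ Icc a b
  · simpa only [nthDeriv_restrict hw] using
      norm_le_derivSup hab n (smooth_restrict hw hab) ⟨x, hx⟩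
  · have hzero : w =ᶠ[𝓝 x] 0 := notMem_tsupport_iff_eventuallyEq.1 fun h => hx (hsupp h)
    simpa [hzero.iteratedDeriv_eq n] using derivSup_nonneg hab n _

lemma term_translate_le (hsupp : tsupport w ⊆ Icc a b) (c : ℝ) (n : ℕ) :
    term hab M (fun x => w (x + c)) n ≤ term hab M (fun x => w x) n := by
  have hwc : ContDiff ℝ ∞ fun x => w (x + c) := hw.comp (contDiff_id.add contDiff_const)
  refine div_le_div_of_nonneg_right (derivSup_le hab fun x => ?_) (M.pos n).le
  rw [nthDeriv_restrict hwc, iteratedDeriv_comp_add_const]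
  exact norm_iteratedDeriv_le_derivSup hw hsupp n _

variable (hsupp : tsupport w ⊆ Icc a b) (c : ℝ)
  (hmem : (fun x : Icc a b => w x) ∈ subalgebra hab M)
include hsupp hmem

lemma translate_mem_subalgebra : (fun x : Icc a b => w (x + c)) ∈ subalgebra hab M :=
  have hwc : ContDiff ℝ ∞ fun x => w (x + c) := hw.comp (contDiff_id.add contDiff_const)
  ⟨smooth_restrict hwc hab,
    .of_nonneg_of_le (term_nonneg hab M _) (term_translate_le hw hsupp c) hmem.2⟩

lemma norm_translate_le : ‖ofMem (translate_mem_subalgebra hw hsupp c hmem)‖ ≤ ‖ofMem hmem‖ :=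
  (translate_mem_subalgebra hw hsupp c hmem).2.tsum_le_tsum (term_translate_le hw hsupp c) hmem.2

end Restrict

lemma restrict_mul_iccExtend (hab : a < b) (χ : ℝ → ℂ) (f : Icc a b → ℂ) :
    (fun x : Icc a b => (χ * IccExtend hab.le f) x) = (fun x : Icc a b => χ x) * f := by
  ext x
  simp only [Pi.mul_apply, Set.IccExtend_val]

section CutoffTranslate

variable {χ : ℝ → ℂ} (hχ : ContDiff ℝ ∞ χ) (hsupp : tsupport χ ⊆ Set.Ioo a b)

include hχ hsupp in
lemma contDiff_mul_iccExtend {f : Icc a b → ℂ} (hf : Smooth hab f) :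
    ContDiff ℝ ∞ (χ * IccExtend hab.le f) :=
  contMDiff_iff_contDiff.1 <| contMDiff_of_tsupport fun _ hx =>
    have hx' := hsupp (closure_mono (Function.support_mul_subset_left _ _) hx)
    (hχ.contDiffAt.mul (hf.contDiffAt (Icc_mem_nhds hx'.1 hx'.2))).contMDiffAt

include hsupp in
lemma tsupport_mul_iccExtend_subset (hab : a < b) (f : Icc a b → ℂ) :
    tsupport (χ * IccExtend hab.le f) ⊆ Icc a b :=
  (closure_mono (Function.support_mul_subset_left _ _)).trans
    (hsupp.trans Set.Ioo_subset_Icc_self)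

variable (hmem : (fun x : Icc a b => χ x) ∈ subalgebra hab M)

include hmem in
lemma mul_iccExtend_mem_subalgebra (f : DAlg hab M) :
    (fun x : Icc a b => (χ * IccExtend hab.le f) x) ∈ subalgebra hab M :=
  restrict_mul_iccExtend hab χ f ▸ (subalgebra hab M).mul_mem hmem f.2

include hχ hsupp hmem in
lemma translate_mul_iccExtend_mem_subalgebra (c : ℝ) (f : DAlg hab M) :
    (fun x : Icc a b => (χ * IccExtend hab.le f) (x + c)) ∈ subalgebra hab M :=
  translate_mem_subalgebra (contDiff_mul_iccExtend hχ hsupp f.2.1)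
    (tsupport_mul_iccExtend_subset hsupp hab f) c (mul_iccExtend_mem_subalgebra hmem f)

lemma norm_translate_mul_iccExtend_le (c : ℝ) (f : DAlg hab M) :
    ‖ofMem (translate_mul_iccExtend_mem_subalgebra hχ hsupp hmem c f)‖ ≤ ‖ofMem hmem‖ * ‖f‖ :=
  calc ‖ofMem (translate_mul_iccExtend_mem_subalgebra hχ hsupp hmem c f)‖
      ≤ ‖ofMem (mul_iccExtend_mem_subalgebra hmem f)‖ :=
        norm_translate_le (contDiff_mul_iccExtend hχ hsupp f.2.1)
          (tsupport_mul_iccExtend_subset hsupp hab f) c (mul_iccExtend_mem_subalgebra hmem f)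
    _ = ‖ofMem hmem * f‖ :=
        congrArg norm (DAlg.ext fun x => congrFun (restrict_mul_iccExtend hab χ f) x)
    _ ≤ ‖ofMem hmem‖ * ‖f‖ := norm_mul_le _ _

/-- The operator `f ↦ (χ f)(· + c)` on `D([a, b], M)`, for `χ` in this algebra supported in
`(a, b)`; the product `χ f` is extended by `0` outside `[a, b]`. -/
noncomputable def cutoffTranslate (c : ℝ) : DAlg hab M →L[ℂ] DAlg hab M :=
  LinearMap.mkContinuous
    { toFun := fun f => ofMem (translate_mul_iccExtend_mem_subalgebra hχ hsupp hmem c f)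
      map_add' := fun _ _ => DAlg.ext fun _ => mul_add _ _ _
      map_smul' := fun _ _ => DAlg.ext fun _ => mul_left_comm _ _ _ }
    ‖ofMem hmem‖ (norm_translate_mul_iccExtend_le hχ hsupp hmem c)

lemma cutoffTranslate_apply (c : ℝ) (f : DAlg hab M) (x : Icc a b) :
    cutoffTranslate hχ hsupp hmem c f x = (χ * IccExtend hab.le f) (x + c) := rfl

end CutoffTranslate

section Vanishing

lemma norm_nthDeriv_le (f : DAlg hab M) (n : ℕ) (x : Icc a b) :
    ‖nthDeriv hab n f x‖ ≤ M.seq n * ‖f‖ := by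
  have h := f.2.2.le_tsum n fun m _ => term_nonneg hab M f m
  rw [term, div_le_iff₀' (M.pos n)] at h
  exact (norm_le_derivSup hab n f.2.1 x).trans h

/-- The functional `f ↦ f⁽ⁿ⁾(x)` on `D([a, b], M)`. -/
noncomputable def derivAt (n : ℕ) (x : Icc a b) : DAlg hab M →L[ℂ] ℂ :=
  LinearMap.mkContinuous
    { toFun := fun f => nthDeriv hab n f x
      map_add' := fun f g => nthDeriv_add hab n f.2.1 g.2.1 x
      map_smul' := fun c f => nthDeriv_smul hab n c f.2.1 x } (M.seq n)
    fun f => norm_nthDeriv_le f n x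

/-- The functions in `D([a, b], M)` that vanish to order `n` at `x`. -/
noncomputable def vanishing (hab : a < b) (M : WeightSeq) (x : Icc a b) (n : ℕ) :
    Submodule ℂ (DAlg hab M) :=
  ⨅ j : Fin n, (derivAt (j : ℕ) x).ker

lemma isClosed_vanishing (x : Icc a b) (n : ℕ) :
    IsClosed (vanishing hab M x n : Set (DAlg hab M)) := by
  rw [vanishing, Submodule.coe_iInf]
  exact isClosed_iInter fun j => (derivAt (j : ℕ) x).isClosed_ker

lemma mem_vanishing {x : Icc a b} {n : ℕ} {f : DAlg hab M} :
    f ∈ vanishing hab M x n ↔ ∀ j < n, nthDeriv hab j f x = 0 := by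
  simp only [vanishing, Submodule.mem_iInf, Fin.forall_iff]
  rfl

lemma coord_mem : (fun x : Icc a b => ((x : ℝ) : ℂ)) ∈ subalgebra hab M := by
  have hw : ContDiff ℝ ∞ fun x : ℝ => (x : ℂ) := Complex.ofRealCLM.contDiff
  refine ⟨smooth_restrict hw hab, summable_of_ne_finset_zero (s := {0, 1}) fun n hn => ?_⟩
  have hderiv : deriv (fun x : ℝ => (x : ℂ)) = fun _ => 1 :=
    funext fun x => (Complex.ofRealCLM.hasDerivAt (x := x)).deriv
  obtain ⟨m, rfl⟩ : ∃ m, n = m + 2 := ⟨n - 2, by grind⟩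
  have hzero : derivSup hab (m + 2) (fun x : Icc a b => ((x : ℝ) : ℂ)) ≤ 0 :=
    derivSup_le hab fun x => by
      rw [nthDeriv_restrict hw, iteratedDeriv_succ', hderiv, iteratedDeriv_const]
      simp
  rw [term, le_antisymm hzero (derivSup_nonneg hab _ _), zero_div]

variable {x : Icc a b} (hx : (x : ℝ) ∈ Set.Ioo a b) {n : ℕ} {f : DAlg hab M}
include hx

lemma exists_hasLeadingTerm_of_mem_vanishing (hf : f ∈ vanishing hab M x n) :
    ∃ α, HasLeadingTerm (IccExtend hab.le f) x n α :=
  ⟨_, hasLeadingTerm_of_iteratedDerivWithin_eq_zero (f.2.1.of_le (by exact_mod_cast le_top))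
    (convex_Icc a b) (Icc_mem_nhds hx.1 hx.2) (mem_vanishing.1 hf)⟩

lemma mem_vanishing_succ_of_hasLeadingTerm_zero
    (h : HasLeadingTerm (IccExtend hab.le f) x n 0) : f ∈ vanishing hab M x (n + 1) := by
  have hf : ContDiffOn ℝ n (IccExtend hab.le f) (Icc a b) := f.2.1.of_le (by exact_mod_cast le_top)
  have hnhds := Icc_mem_nhds hx.1 hx.2
  refine mem_vanishing.2 fun j hj => ?_
  rcases Nat.lt_succ_iff_lt_or_eq.1 hj with hj | rfl
  · exact h.iteratedDerivWithin_eq_zero hf (convex_Icc a b) hnhds hj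
  · have hzero := h.eq_iteratedDerivWithin hf (convex_Icc a b) hnhds
    exact (smul_eq_zero.1 hzero.symm).resolve_left (by positivity)

lemma exists_hasLeadingTerm_one (n : ℕ) :
    ∃ f : DAlg hab M, HasLeadingTerm (IccExtend hab.le f) x n 1 := by
  refine ⟨(ofMem coord_mem - algebraMap ℂ (DAlg hab M) x) ^ n, 1, tendsto_const_nhds, ?_⟩
  filter_upwards [Icc_mem_nhds hx.1 hx.2] with y hy
  rw [Set.IccExtend_of_mem hab.le _ hy, Pi.one_apply, Complex.real_smul, mul_one,
    Complex.ofReal_pow, Complex.ofReal_sub]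
  rfl

lemma vanishing_succ_lt : vanishing hab M x (n + 1) < vanishing hab M x n := by
  obtain ⟨f, hf⟩ := exists_hasLeadingTerm_one (hab := hab) (M := M) hx n
  refine SetLike.lt_iff_le_and_exists.2
    ⟨fun g hg => mem_vanishing.2 fun j hj => mem_vanishing.1 hg j (hj.trans n.lt_succ_self),
      f, mem_vanishing.2 fun j hj => hf.iteratedDerivWithin_eq_zero
        (f.2.1.of_le (by exact_mod_cast le_top)) (convex_Icc a b) (Icc_mem_nhds hx.1 hx.2) hj,
      fun hmem => ?_⟩
  obtain ⟨α, hα⟩ := exists_hasLeadingTerm_of_mem_vanishing hx hmem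
  exact one_ne_zero (hf.unique (hα.of_lt n.lt_succ_self))

end Vanishing

section CompactEndomorphism

variable {φ : Icc a b → Icc a b} {x : Icc a b} (hx : (x : ℝ) ∈ Set.Ioo a b)

lemma differentiableOn_realMap (hφ : InducesCompactEndomorphism hab M φ) :
    DifferentiableOn ℝ (realMap hab φ) (Icc a b) := by
  obtain ⟨T, hT, -⟩ := hφ
  have hTz : DifferentiableOn ℝ (IccExtend hab.le (T (ofMem coord_mem))) (Icc a b) :=
    (T (ofMem coord_mem)).2.1.differentiableOn (by simp)
  refine (Complex.reCLM.differentiable.comp_differentiableOn hTz).congr fun x hx => ?_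
  rw [realMap, Set.IccExtend_of_mem hab.le _ hx, Function.comp_apply,
    Set.IccExtend_of_mem hab.le _ hx, hT]
  exact (Complex.ofReal_re _).symm

include hx

lemma hasLeadingTerm_map_cutoffTranslate {χ : ℝ → ℂ} (hχ : ContDiff ℝ ∞ χ)
    (hsupp : tsupport χ ⊆ Set.Ioo a b) (hmem : (fun x : Icc a b => χ x) ∈ subalgebra hab M)
    {T : DAlg hab M →ₐ[ℂ] DAlg hab M} (hT : ∀ (f : DAlg hab M) (x : Icc a b), T f x = f (φ x))
    {l : ℝ} (hl : HasDerivAt (realMap hab φ) l x) {n : ℕ} {f : DAlg hab M} {α : ℂ}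
    (hf : HasLeadingTerm (IccExtend hab.le f) x n α) :
    HasLeadingTerm (IccExtend hab.le (T (cutoffTranslate hχ hsupp hmem (x - φ x) f))) x n
      ((l : ℂ) ^ n * χ x * α) := by
  have hfix : realMap hab φ x + (x - φ x) = x := by simp [realMap]
  have hcomp := (hf.mul_left hχ.continuous.continuousAt).comp (hl.add_const (x - φ x : ℝ)) hfix
  rw [Complex.real_smul, Complex.ofReal_pow, ← mul_assoc] at hcomp
  refine hcomp.congr ?_
  filter_upwards [Icc_mem_nhds hx.1 hx.2] with y hy
  rw [Set.IccExtend_of_mem hab.le _ hy, hT, cutoffTranslate_apply, Function.comp_apply, realMap,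
    Set.IccExtend_of_mem hab.le _ hy]

theorem abs_lt_one_of_inducesCompactEndomorphism (hM : M.NonQuasiAnalytic)
    (hφ : InducesCompactEndomorphism hab M φ) {l : ℝ} (hl : HasDerivAt (realMap hab φ) l x) :
    |l| < 1 := by
  obtain ⟨T, hT, hcomp⟩ := hφ
  obtain ⟨χ, hχ, hχx, hsupp, B, hB, hBs⟩ := hM.exists_bump_of_mem_nhds (Ioo_mem_nhds hx.1 hx.2)
  have hmem : (fun x : Icc a b => χ x) ∈ subalgebra hab M :=
    restrict_mem_subalgebra hχ (fun n x _ => hB n x) hBs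
  have hdiag (n : ℕ) (f : DAlg hab M) (hf : f ∈ vanishing hab M x n) :
      T (cutoffTranslate hχ hsupp hmem (x - φ x) f) - ((l : ℂ) ^ n * χ x) • f ∈
        vanishing hab M x (n + 1) := by
    obtain ⟨α, hα⟩ := exists_hasLeadingTerm_of_mem_vanishing hx hf
    refine mem_vanishing_succ_of_hasLeadingTerm_zero hx ?_
    have hsub := (hasLeadingTerm_map_cutoffTranslate hx hχ hsupp hmem hT hl hα).sub
      (hα.mul_left (u := fun _ => (l : ℂ) ^ n * χ x) continuousAt_const)
    rwa [sub_self] at hsub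
  have hlim : Tendsto (fun n => (l : ℂ) ^ n * χ x) atTop (𝓝 0) :=
    tendsto_zero_of_isCompactOperator_of_flag
      (K := T.toLinearMap ∘ₗ (cutoffTranslate hχ hsupp hmem (x - φ x)).toLinearMap)
      (hcomp.comp_clm _) (fun _ => vanishing_succ_lt hx) (isClosed_vanishing x) hdiag
  have hpow : Tendsto (fun n => |l| ^ n) atTop (𝓝 0) := by
    simpa [hχx] using (hlim.mul_const (χ x)⁻¹).norm
  simpa using tendsto_pow_atTop_nhds_zero_iff.1 hpow

lemma abs_selfmapDeriv_lt_one (hM : M.NonQuasiAnalytic)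
    (hφ : InducesCompactEndomorphism hab M φ) : |selfmapDeriv hab φ x| < 1 :=
  abs_lt_one_of_inducesCompactEndomorphism hx hM hφ
    ((differentiableOn_realMap hφ x x.2).hasDerivWithinAt.hasDerivAt (Icc_mem_nhds hx.1 hx.2))

end CompactEndomorphism

end DAlg

theorem theorem1p5_general {a b : ℝ} (hab : a < b) (M : WeightSeq) (hM : M.NonQuasiAnalytic)
    (φ : Icc a b → Icc a b) (hφ : DAlg.InducesCompactEndomorphism hab M φ) :
    DifferentiableOn ℝ (DAlg.realMap hab φ) (Icc a b) ∧
    (∀ x : Icc a b, (x : ℝ) ∈ Set.Ioo a b → |DAlg.selfmapDeriv hab φ x| < 1) ∧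
    ((∃ x₀ : Icc a b, (x₀ : ℝ) ∈ Set.Ioo a b ∧
        ∀ x, |DAlg.selfmapDeriv hab φ x| ≤ |DAlg.selfmapDeriv hab φ x₀|) →
      (⨆ x, |DAlg.selfmapDeriv hab φ x|) < 1) := by
  have hlt (x : Icc a b) (hx : (x : ℝ) ∈ Set.Ioo a b) : |DAlg.selfmapDeriv hab φ x| < 1 :=
    DAlg.abs_selfmapDeriv_lt_one hx hM hφ
  refine ⟨DAlg.differentiableOn_realMap hφ, hlt, fun ⟨x₀, hx₀, hmax⟩ => ?_⟩
  have : Nonempty (Icc a b) := ⟨x₀⟩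
  exact (ciSup_le hmax).trans_lt (hlt x₀ hx₀)

theorem theorem1p5 (M : WeightSeq) (hM : M.NonQuasiAnalytic)
    (φ : Set.Icc (0 : ℝ) 1 → Set.Icc (0 : ℝ) 1)
    (hφ : DAlg.InducesCompactEndomorphism zero_lt_one M φ) :
    DifferentiableOn ℝ (DAlg.realMap zero_lt_one φ) (Set.Icc 0 1) ∧
    (∀ x : Set.Icc (0 : ℝ) 1, (x : ℝ) ∈ Set.Ioo (0 : ℝ) 1 →
      |DAlg.selfmapDeriv zero_lt_one φ x| < 1) ∧
    ((∃ x₀ : Set.Icc (0 : ℝ) 1, (x₀ : ℝ) ∈ Set.Ioo (0 : ℝ) 1 ∧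
        ∀ x, |DAlg.selfmapDeriv zero_lt_one φ x| ≤ |DAlg.selfmapDeriv zero_lt_one φ x₀|) →
      (⨆ x, |DAlg.selfmapDeriv zero_lt_one φ x|) < 1) :=
  theorem1p5_general zero_lt_one M hM φ hφ
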